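/- Throughout, digraphs are finite and oriented, that is, they have no loops, no parallel edges and no antiparallel edges. A feedback arc set of a digraph $G=(V,E)$ is a set $S\subseteq E$ such that $(V,E\setminus S)$ contains no directed cycle, and $\beta(G)$ denotes the minimum size of a feedback arc set of $G$. A digraph is bipartite if its underlying undirected graph is bipartite, and $G$ is $B$-free if it has no subdigraph (not necessarily induced) isomorphic to $B$. Theorem. For each bipartite digraph $B$ there are constants $c,\varepsilon>0$, depending only on $B$, such that every $B$-free digraph $G$ with $m$ edges satisfies $$\beta(G)\le \frac m2 - c\,m^{3/4+\varepsilon}.$$ -/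

import Mathlib

namespace Digraph

/-- A digraph is oriented if it has no loops and no pair of antiparallel edges
(parallel edges do not exist in a `Digraph`). -/
def IsOriented {V : Type*} (G : Digraph V) : Prop :=
  (∀ a, ¬ G.Adj a a) ∧ ∀ a b, G.Adj a b → ¬ G.Adj b a

/-- The set of directed edges `(a, b)`, `a → b`. -/
def edges {V : Type*} (G : Digraph V) : Set (V × V) :=
  {e | G.Adj e.1 e.2}

/-- The digraph on the same vertices in which the edges in `S` are deleted. -/
def removeEdges {V : Type*} (G : Digraph V) (S : Set (V × V)) : Digraph V where
  Adj a b := G.Adj a b ∧ (a, b) ∉ S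

/-- `v 0 → v 1 → ⋯ → v k → v 0` is a directed cycle, of length `k + 1`, on distinct vertices.
Addition in `Fin (k + 1)` is modulo `k + 1`. -/
def IsDirectedCycle {V : Type*} (G : Digraph V) {k : ℕ} (v : Fin (k + 1) → V) : Prop :=
  Function.Injective v ∧ ∀ i, G.Adj (v i) (v (i + 1))

/-- A digraph is acyclic if it has no directed cycle, of any length at least `1`. -/
def IsAcyclic {V : Type*} (G : Digraph V) : Prop :=
  ∀ (k : ℕ) (v : Fin (k + 1) → V), ¬ G.IsDirectedCycle v

/-- A feedback arc set is a set of edges whose deletion leaves an acyclic digraph. -/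
def IsFeedbackArcSet {V : Type*} (G : Digraph V) (S : Set (V × V)) : Prop :=
  S ⊆ G.edges ∧ (G.removeEdges S).IsAcyclic

/-- The minimum size `β(G)` of a feedback arc set of a finite digraph `G`. -/
noncomputable def minFeedbackArc {V : Type*} (G : Digraph V) : ℕ :=
  sInf {k : ℕ | ∃ S : Set (V × V), G.IsFeedbackArcSet S ∧ S.ncard = k}

/-- `G` contains `B` as a (not necessarily induced) subdigraph. -/
def ContainsCopy {V W : Type*} (G : Digraph V) (B : Digraph W) : Prop :=
  ∃ f : W → V, Function.Injective f ∧ ∀ a b, B.Adj a b → G.Adj (f a) (f b)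

/-- A digraph is bipartite if its underlying undirected graph is. -/
def IsBipartite {V : Type*} (G : Digraph V) : Prop :=
  G.toSimpleGraphInclusive.IsBipartite

end Digraph

/-! Write s = m − 2β(G) for the surplus and h for the number of vertices of B; suppose s is barely
above m^(3/4). For any sets X, Y, the edges from X to Y minus those from Y to X number O(s): put X
before Y and average over two opposite placements of the other vertices. This cut bound on the skew
adjacency matrix has two consequences.

Low degrees: testing the bound on random sign vectors and applying Khintchine's inequality row by
row shows that vertices of degree at most r² have total degree O(rs). With r slightly below m^(1/4),
most edges survive among the n = O(m/r²) remaining vertices, which therefore span a rather dense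
digraph.

Counting: reversing one edge in an orientation of K_{h,h} changes its number of homomorphisms into
these n vertices by O(s n^(2h−2)), so all orientations occur about equally often. Together they
number at least n^(2h) d^(h²), where d is the edge density, by convexity. Yet some orientation
forces a copy of B as soon as both sides are mapped injectively, so in a B-free digraph it has only
O(n^(2h−1)) homomorphisms. The bounds clash once m is large, with room for an exponent gain of
1/(40h²). -/

namespace Digraph

/-! ### Adjacency matrices and the surplus -/

open scoped Classical in
/-- The adjacency matrix of a digraph, with real entries. -/
noncomputable def ind {V : Type*} (G : Digraph V) (u v : V) : ℝ := if G.Adj u v then 1 else 0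

/-- The skew-symmetric adjacency matrix of a digraph. -/
noncomputable def skew {V : Type*} (G : Digraph V) (u v : V) : ℝ := G.ind u v - G.ind v u

/-- The adjacency matrix of the underlying multigraph of a digraph. -/
noncomputable def symInd {V : Type*} (G : Digraph V) (u v : V) : ℝ := G.ind u v + G.ind v u

/-- Twice the largest amount by which an ordering beats a random one: the number of edges
minus twice the size of a minimum feedback arc set. -/
noncomputable def surplus {V : Type*} (G : Digraph V) : ℝ :=
  (G.edges.ncard : ℝ) - 2 * (G.minFeedbackArc : ℝ)

theorem ind_nonneg {V : Type*} (G : Digraph V) (u v : V) : 0 ≤ G.ind u v := by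
  unfold ind; split_ifs <;> norm_num

theorem ind_eq_zero_or_one {V : Type*} (G : Digraph V) (u v : V) :
    G.ind u v = 0 ∨ G.ind u v = 1 := by
  unfold ind; split_ifs <;> simp

theorem skew_swap {V : Type*} (G : Digraph V) (u v : V) : G.skew v u = -G.skew u v := by
  unfold skew; ring

theorem symInd_nonneg {V : Type*} (G : Digraph V) (u v : V) : 0 ≤ G.symInd u v :=
  add_nonneg (G.ind_nonneg _ _) (G.ind_nonneg _ _)

theorem symInd_swap {V : Type*} (G : Digraph V) (u v : V) : G.symInd v u = G.symInd u v := by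
  unfold symInd; ring

theorem IsOriented.skew_sq {V : Type*} {G : Digraph V} (hG : G.IsOriented) (u v : V) :
    G.skew u v ^ 2 = G.symInd u v := by
  unfold skew symInd ind
  have := hG.2 u v
  split_ifs <;> simp_all

/-! ### Orderings and the cut bound on the skew matrix -/

section Ordering

variable {V : Type*} [Fintype V] {G : Digraph V}

theorem sum_ite_adj_and_eq_ncard (G : Digraph V) (p : V → V → Prop)
    [∀ u v, Decidable (G.Adj u v ∧ p u v)] :
    ∑ u, ∑ v, (if G.Adj u v ∧ p u v then (1 : ℝ) else 0) =
      ({e : V × V | G.Adj e.1 e.2 ∧ p e.1 e.2}.ncard : ℝ) := by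
  classical
  rw [← Fintype.sum_prod_type', Finset.sum_boole, Set.ncard_eq_toFinset_card']
  congr 2
  ext e
  simp

theorem sum_ind (G : Digraph V) : ∑ u, ∑ v, G.ind u v = (G.edges.ncard : ℝ) := by
  classical
  unfold ind edges
  simpa using sum_ite_adj_and_eq_ncard G (fun _ _ => True)

theorem sum_symInd (G : Digraph V) : ∑ u, ∑ v, G.symInd u v = 2 * (G.edges.ncard : ℝ) := by
  unfold symInd
  simp only [Finset.sum_add_distrib]
  rw [Finset.sum_comm (f := fun u v => G.ind v u), sum_ind]
  ring

/-- On a cycle avoiding the backward edges `g` would increase at every step, but summing around the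
cycle gives the same total on both sides. -/
theorem IsOriented.isFeedbackArcSet_backward {V : Type*} {G : Digraph V} (hG : G.IsOriented) {g : V → ℤ}
    (hg : Function.Injective g) :
    G.IsFeedbackArcSet {e : V × V | G.Adj e.1 e.2 ∧ g e.2 < g e.1} := by
  refine ⟨fun e he => he.1, fun k v hv => ?_⟩
  have hlt : ∀ i, g (v i) < g (v (i + 1)) := by
    intro i
    obtain ⟨hadj, hS⟩ := hv.2 i
    have hle : g (v i) ≤ g (v (i + 1)) := by
      by_contra h
      exact hS ⟨hadj, by simpa using h⟩
    refine lt_of_le_of_ne hle fun h => hG.1 (v i) ?_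
    rw [← hg h] at hadj
    exact hadj
  have hsum : ∑ i, g (v i) < ∑ i, g (v (i + 1)) :=
    Finset.sum_lt_sum_of_nonempty Finset.univ_nonempty fun i _ => hlt i
  exact hsum.ne' (Equiv.sum_comp (Equiv.addRight (1 : Fin (k + 1))) fun i => g (v i))

theorem IsOriented.sum_ind_mul_sign_le_of_injective (hG : G.IsOriented) {g : V → ℤ}
    (hg : Function.Injective g) :
    ∑ u, ∑ v, G.ind u v * ((g v - g u).sign : ℝ) ≤ G.surplus := by
  classical
  have hβ : G.minFeedbackArc ≤ {e : V × V | G.Adj e.1 e.2 ∧ g e.2 < g e.1}.ncard :=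
    Nat.sInf_le ⟨_, hG.isFeedbackArcSet_backward hg, rfl⟩
  have hpt : ∀ u v, G.ind u v * ((g v - g u).sign : ℝ) =
      G.ind u v - 2 * (if G.Adj u v ∧ g v < g u then (1 : ℝ) else 0) := by
    intro u v
    unfold ind
    by_cases h : G.Adj u v
    · rcases lt_trichotomy (g v) (g u) with hlt | heq | hgt
      · rw [Int.sign_eq_neg_one_of_neg (by omega)]
        simp only [h, hlt]; norm_num
      · exact absurd (hg heq ▸ h) (hG.1 _)
      · rw [Int.sign_eq_one_of_pos (by omega)]
        simp [h, hgt.not_gt]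
    · simp [h]
  simp only [hpt, Finset.sum_sub_distrib, ← Finset.mul_sum]
  rw [sum_ind, sum_ite_adj_and_eq_ncard G (fun u v => g v < g u)]
  unfold surplus
  have : (G.minFeedbackArc : ℝ) ≤ _ := Nat.cast_le.2 hβ
  linarith

/-- Ties in an ordering may be broken at random. -/
theorem IsOriented.sum_ind_mul_sign_le (hG : G.IsOriented) (f : V → ℤ) :
    ∑ u, ∑ v, G.ind u v * ((f v - f u).sign : ℝ) ≤ G.surplus := by
  classical
  set n : ℤ := (Fintype.card V : ℤ) with hn
  let τ : V → ℤ := fun v => (Fintype.equivFin V v : ℕ)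
  have hτ0 : ∀ v, 0 ≤ τ v := fun v => by positivity
  have hτn : ∀ v, τ v < n := fun v => by
    simp only [τ, hn]; exact_mod_cast (Fintype.equivFin V v).2
  have hτ : Function.Injective τ := by
    intro a b hab
    simpa [τ, Fin.val_inj] using hab
  have key : ∀ u v, f u < f v → n * f u + n ≤ n * f v := by
    intro u v h
    nlinarith [hτ0 u, hτn u]
  -- As 0 ≤ `τ` < `n`, both `n * f + τ` and `n * f - τ` refine the order by `f`. They break ties in
  -- opposite ways, so tied pairs cancel in the average.
  have h1 := hG.sum_ind_mul_sign_le_of_injective (g := fun v => n * f v + τ v) (by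
    intro a b hab
    have := hτ0 a; have := hτ0 b; have := hτn a; have := hτn b
    simp only at hab
    rcases lt_trichotomy (f a) (f b) with h | h | h
    · have := key _ _ h; omega
    · rw [h] at hab; exact hτ (by omega)
    · have := key _ _ h; omega)
  have h2 := hG.sum_ind_mul_sign_le_of_injective (g := fun v => n * f v - τ v) (by
    intro a b hab
    have := hτ0 a; have := hτ0 b; have := hτn a; have := hτn b
    simp only at hab
    rcases lt_trichotomy (f a) (f b) with h | h | h
    · have := key _ _ h; omega
    · rw [h] at hab; exact hτ (by omega)
    · have := key _ _ h; omega)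
  have hs : ∀ u v, ((f v - f u).sign : ℝ) * 2 =
      ((n * f v + τ v - (n * f u + τ u)).sign : ℝ) +
      ((n * f v - τ v - (n * f u - τ u)).sign : ℝ) := by
    intro u v
    have := hτ0 u; have := hτ0 v; have := hτn u; have := hτn v
    rcases lt_trichotomy (f u) (f v) with h | h | h
    · have := key _ _ h
      rw [Int.sign_eq_one_of_pos (a := f v - f u) (by omega),
        Int.sign_eq_one_of_pos (by omega), Int.sign_eq_one_of_pos (by omega)]
      norm_num
    · rw [h, show n * f v + τ v - (n * f v + τ u) = -(n * f v - τ v - (n * f v - τ u)) by ring,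
        Int.sign_neg]
      simp
    · have := key _ _ h
      rw [Int.sign_eq_neg_one_of_neg (a := f v - f u) (by omega),
        Int.sign_eq_neg_one_of_neg (by omega), Int.sign_eq_neg_one_of_neg (by omega)]
      norm_num
  have h3 := add_le_add h1 h2
  simp only [← Finset.sum_add_distrib, ← mul_add, ← hs] at h3
  simp only [← mul_assoc, ← Finset.sum_mul] at h3
  linarith

theorem IsOriented.sum_skew_le_of_disjoint (hG : G.IsOriented) {X Y : Finset V}
    (hXY : Disjoint X Y) : ∑ u ∈ X, ∑ v ∈ Y, G.skew u v ≤ G.surplus := by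
  classical
  -- The remaining vertices go last in one ordering and first in the other, so the pairs they form
  -- with `X` and `Y` cancel.
  have h1 := hG.sum_ind_mul_sign_le (fun v => if v ∈ X then 0 else if v ∈ Y then 1 else 2)
  have h2 := hG.sum_ind_mul_sign_le (fun v => if v ∈ X then 0 else if v ∈ Y then 1 else -1)
  have hpt : ∀ u v, ((((if v ∈ X then 0 else if v ∈ Y then 1 else 2 : ℤ) -
        (if u ∈ X then 0 else if u ∈ Y then 1 else 2)).sign : ℤ) : ℝ) +
      ((((if v ∈ X then 0 else if v ∈ Y then 1 else -1 : ℤ) -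
        (if u ∈ X then 0 else if u ∈ Y then 1 else -1)).sign : ℤ) : ℝ) =
      2 * ((if u ∈ X then 1 else 0) * (if v ∈ Y then 1 else 0) -
        (if v ∈ X then 1 else 0) * (if u ∈ Y then 1 else 0)) := by
    intro u v
    have hu : u ∈ X → u ∉ Y := fun h => Finset.disjoint_left.1 hXY h
    have hv : v ∈ X → v ∉ Y := fun h => Finset.disjoint_left.1 hXY h
    by_cases a : u ∈ X <;> by_cases b : v ∈ X <;> by_cases c : u ∈ Y <;> by_cases d : v ∈ Y <;>
      simp_all <;> norm_num [show Int.sign 2 = 1 from rfl]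
  have e1 : ∑ u ∈ X, ∑ v ∈ Y, G.ind u v =
      ∑ u, ∑ v, G.ind u v * ((if u ∈ X then 1 else 0) * (if v ∈ Y then 1 else 0)) := by
    have h : ∀ u, ∑ v, G.ind u v * ((if u ∈ X then 1 else 0) * (if v ∈ Y then 1 else 0)) =
        if u ∈ X then ∑ v ∈ Y, G.ind u v else 0 := fun u => by
      split_ifs <;> simp [Finset.sum_ite_mem]
    simp only [h, Finset.sum_ite_mem, Finset.univ_inter]
  have e2 : ∑ u ∈ X, ∑ v ∈ Y, G.ind v u =
      ∑ u, ∑ v, G.ind u v * ((if v ∈ X then 1 else 0) * (if u ∈ Y then 1 else 0)) := by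
    have h : ∀ u, ∑ v, G.ind u v * ((if v ∈ X then 1 else 0) * (if u ∈ Y then 1 else 0)) =
        if u ∈ Y then ∑ v ∈ X, G.ind u v else 0 := fun u => by
      split_ifs <;> simp [Finset.sum_ite_mem]
    simp only [h, Finset.sum_ite_mem, Finset.univ_inter]
    exact Finset.sum_comm
  have h3 := add_le_add h1 h2
  simp only [← Finset.sum_add_distrib, ← mul_add, hpt] at h3
  simp only [mul_left_comm _ (2 : ℝ), mul_sub, Finset.sum_sub_distrib, ← Finset.mul_sum] at h3
  unfold skew
  simp only [Finset.sum_sub_distrib, e1, e2]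
  linarith

theorem IsOriented.surplus_nonneg (hG : G.IsOriented) : 0 ≤ G.surplus := by
  simpa using hG.sum_skew_le_of_disjoint (X := ∅) (Y := ∅) (by simp)

/-- The block on `X ∩ Y` vanishes by skew-symmetry, which leaves three pairs of disjoint sets. -/
theorem IsOriented.sum_skew_le (hG : G.IsOriented) (X Y : Finset V) :
    ∑ u ∈ X, ∑ v ∈ Y, G.skew u v ≤ 3 * G.surplus := by
  classical
  have hX : ∀ F : V → ℝ, ∑ u ∈ X, F u = ∑ u ∈ X \ Y, F u + ∑ u ∈ X ∩ Y, F u := fun F => by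
    rw [← Finset.sum_union (Finset.disjoint_sdiff_inter X Y), Finset.sdiff_union_inter]
  have hY : ∀ F : V → ℝ, ∑ u ∈ Y, F u = ∑ u ∈ Y \ X, F u + ∑ u ∈ X ∩ Y, F u := fun F => by
    rw [Finset.inter_comm, ← Finset.sum_union (Finset.disjoint_sdiff_inter Y X),
      Finset.sdiff_union_inter]
  have h0 : ∑ u ∈ X ∩ Y, ∑ v ∈ X ∩ Y, G.skew u v = 0 := by
    have h := Finset.sum_comm (s := X ∩ Y) (t := X ∩ Y) (f := fun u v => G.skew u v)
    have h' : ∑ v ∈ X ∩ Y, ∑ u ∈ X ∩ Y, G.skew u v = -∑ v ∈ X ∩ Y, ∑ u ∈ X ∩ Y, G.skew v u := by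
      simp only [← Finset.sum_neg_distrib, ← skew_swap]
    linarith
  have d1 : Disjoint (X \ Y) (Y \ X) :=
    Finset.disjoint_left.2 fun a ha hb => (Finset.mem_sdiff.1 hb).2 (Finset.mem_sdiff.1 ha).1
  have d2 : Disjoint (X \ Y) (X ∩ Y) := Finset.disjoint_sdiff_inter X Y
  have d3 : Disjoint (X ∩ Y) (Y \ X) := by
    rw [Finset.inter_comm]; exact (Finset.disjoint_sdiff_inter Y X).symm
  have h1 := hG.sum_skew_le_of_disjoint d1
  have h2 := hG.sum_skew_le_of_disjoint d2
  have h3 := hG.sum_skew_le_of_disjoint d3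
  rw [hX]
  simp only [hY, Finset.sum_add_distrib]
  linarith

theorem IsOriented.abs_sum_skew_le (hG : G.IsOriented) (X Y : Finset V) :
    |∑ u ∈ X, ∑ v ∈ Y, G.skew u v| ≤ 3 * G.surplus := by
  refine abs_le'.2 ⟨hG.sum_skew_le X Y, ?_⟩
  have h := hG.sum_skew_le Y X
  rw [Finset.sum_comm] at h
  simpa only [← Finset.sum_neg_distrib, ← skew_swap] using h

theorem IsOriented.one_le_surplus (hG : G.IsOriented) (hm : 0 < G.edges.ncard) :
    1 ≤ G.surplus := by
  obtain ⟨⟨a, b⟩, hab⟩ := (Set.ncard_pos (Set.toFinite _)).1 hm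
  have hadj : G.Adj a b := hab
  have hne : a ≠ b := fun h => hG.1 a (h ▸ hadj)
  have h := hG.sum_skew_le_of_disjoint (X := {a}) (Y := {b}) (by simpa using hne)
  rw [Finset.sum_singleton, Finset.sum_singleton] at h
  simpa [skew, ind, hadj, hG.2 a b hadj] using h

end Ordering

end Digraph

/-! ### Random signs and Khintchine's inequality -/

section Khintchine

variable {V : Type*} [Fintype V] [DecidableEq V]

/-- The sum of `a` over a finite set, with signs. -/
def signedSum (a : V → ℝ) (s : Finset V) (ε : V → Bool) : ℝ :=
  ∑ u ∈ s, a u * (if ε u then 1 else -1)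

theorem sum_flip (u : V) (F : (V → Bool) → ℝ) :
    ∑ ε : V → Bool, F (Function.update ε u (!ε u)) = ∑ ε, F ε := by
  have h : Function.Involutive fun ε : V → Bool => Function.update ε u (!ε u) := fun ε => by
    simp
  exact Equiv.sum_comp h.toPerm F

theorem signedSum_flip_of_notMem {V : Type*} [DecidableEq V] (a : V → ℝ) {s : Finset V} {u : V} (hu : u ∉ s)
    (ε : V → Bool) (b : Bool) : signedSum a s (Function.update ε u b) = signedSum a s ε := by
  unfold signedSum
  refine Finset.sum_congr rfl fun v hv => ?_
  rw [Function.update_of_ne (ne_of_mem_of_not_mem hv hu)]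

/-- Averaging over the sign of one more term. -/
theorem two_mul_sum_signedSum_insert (a : V → ℝ) {s : Finset V} {u : V} (hu : u ∉ s)
    (φ : ℝ → ℝ) :
    2 * ∑ ε, φ (signedSum a (insert u s) ε) =
      ∑ ε, (φ (signedSum a s ε + a u) + φ (signedSum a s ε - a u)) := by
  have h1 := sum_flip u fun ε => φ (signedSum a (insert u s) ε)
  rw [two_mul]
  nth_rewrite 1 [← h1]
  rw [← Finset.sum_add_distrib]
  refine Finset.sum_congr rfl fun ε _ => ?_
  have h2 : ∀ ε', signedSum a (insert u s) ε' =
      a u * (if ε' u then 1 else -1) + signedSum a s ε' := fun ε' =>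
    Finset.sum_insert hu
  rw [h2, h2, signedSum_flip_of_notMem a hu]
  cases ε u <;> simp [add_comm, sub_eq_add_neg]

theorem sum_signedSum_sq (a : V → ℝ) (s : Finset V) :
    ∑ ε, signedSum a s ε ^ 2 = 2 ^ Fintype.card V * ∑ u ∈ s, a u ^ 2 := by
  induction s using Finset.induction_on with
  | empty => simp [signedSum]
  | insert u s hu ih =>
    have h := two_mul_sum_signedSum_insert a hu (fun y => y ^ 2)
    have h' : ∀ y : ℝ, (y + a u) ^ 2 + (y - a u) ^ 2 = 2 * y ^ 2 + 2 * a u ^ 2 := fun y => by ring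
    simp only [h', Finset.sum_add_distrib, ← Finset.mul_sum, ih] at h
    rw [Finset.sum_insert hu]
    simp at h
    linarith

theorem sum_signedSum_pow_four_le (a : V → ℝ) (s : Finset V) :
    ∑ ε, signedSum a s ε ^ 4 ≤ 2 ^ Fintype.card V * (3 * (∑ u ∈ s, a u ^ 2) ^ 2) := by
  induction s using Finset.induction_on with
  | empty => simp [signedSum]
  | insert u s hu ih =>
    have h := two_mul_sum_signedSum_insert a hu (fun y => y ^ 4)
    have h' : ∀ y : ℝ, (y + a u) ^ 4 + (y - a u) ^ 4 =
        2 * y ^ 4 + 12 * a u ^ 2 * y ^ 2 + 2 * a u ^ 4 := fun y => by ring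
    simp only [h', Finset.sum_add_distrib, ← Finset.mul_sum, sum_signedSum_sq] at h
    rw [Finset.sum_insert hu]
    simp at h
    have : 0 ≤ 2 ^ Fintype.card V * a u ^ 4 := by positivity
    nlinarith

/-- A form of Khintchine's inequality for first moments. -/
theorem sum_sq_le_mul_sum_abs_signedSum (a : V → ℝ) (s : Finset V) {r : ℝ} (hr : 0 < r)
    (h : ∑ u ∈ s, a u ^ 2 ≤ r ^ 2) :
    2 ^ Fintype.card V * ∑ u ∈ s, a u ^ 2 ≤ 4 * r * ∑ ε, |signedSum a s ε| := by
  -- A lower bound for |y| by second and fourth moments. Since the fourth moment is at most 3r²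
  -- times the second, the left side averages to at least 13r² times the second moment, of which 8r²
  -- is used.
  have hpt : ∀ y : ℝ, 16 * r ^ 2 * y ^ 2 - y ^ 4 ≤ 32 * r ^ 3 * |y| := by
    intro y
    rw [← sq_abs y, show y ^ 4 = |y| ^ 4 by rw [pow_abs, abs_of_nonneg (by positivity)]]
    have h1 : 0 ≤ |y| := abs_nonneg y
    have h2 : 0 ≤ |y| ^ 3 - 16 * r ^ 2 * |y| + 32 * r ^ 3 := by
      nlinarith [mul_nonneg (add_nonneg h1 (by positivity : (0 : ℝ) ≤ 5 * r))
        (sq_nonneg (2 * |y| - 5 * r)), pow_pos hr 3, mul_pos hr hr]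
    nlinarith [mul_nonneg h1 h2]
  have hsum := Finset.sum_le_sum fun ε (_ : ε ∈ (Finset.univ : Finset (V → Bool))) =>
    hpt (signedSum a s ε)
  rw [Finset.sum_sub_distrib, ← Finset.mul_sum, ← Finset.mul_sum, sum_signedSum_sq] at hsum
  have h4 := sum_signedSum_pow_four_le a s
  set σ := ∑ u ∈ s, a u ^ 2
  set N : ℝ := 2 ^ Fintype.card V
  have hσ : 0 ≤ σ := Finset.sum_nonneg fun _ _ => sq_nonneg _
  have hN : 0 ≤ N := by positivity
  have h5 : N * (3 * σ ^ 2) ≤ 3 * r ^ 2 * (N * σ) := by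
    nlinarith [mul_nonneg (mul_nonneg hN hσ) (sub_nonneg.2 h)]
  have h6 : r ^ 2 * (N * σ) * 8 ≤ r ^ 2 * (4 * r * ∑ ε, |signedSum a s ε|) * 8 := by
    have : 0 ≤ r ^ 2 * (N * σ) := by positivity
    nlinarith
  exact le_of_mul_le_mul_left (le_of_mul_le_mul_right h6 (by norm_num)) (pow_pos hr 2)

end Khintchine

namespace Digraph

/-! ### Total degree of the low-degree vertices -/

section LowDegree

variable {V : Type*} [Fintype V] {G : Digraph V}

/-- The rows with nonnegative sum and those with negative sum form two sets, each subject to the cut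
bound. -/
theorem IsOriented.sum_abs_sum_skew_le (hG : G.IsOriented) (Y : Finset V) :
    ∑ v, |∑ u ∈ Y, G.skew v u| ≤ 6 * G.surplus := by
  classical
  have h : ∀ v, |∑ u ∈ Y, G.skew v u| = (if 0 ≤ ∑ u ∈ Y, G.skew v u then
      ∑ u ∈ Y, G.skew v u else 0) - (if ¬ 0 ≤ ∑ u ∈ Y, G.skew v u then
      ∑ u ∈ Y, G.skew v u else 0) := by
    intro v
    by_cases h : 0 ≤ ∑ u ∈ Y, G.skew v u
    · simp [h, abs_of_nonneg]
    · simp [h, abs_of_neg (not_le.1 h)]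
  simp only [h, Finset.sum_sub_distrib, ← Finset.sum_filter]
  have h1 := (abs_le.1 (hG.abs_sum_skew_le {v | 0 ≤ ∑ u ∈ Y, G.skew v u} Y)).2
  have h2 := (abs_le.1 (hG.abs_sum_skew_le {v | ¬ 0 ≤ ∑ u ∈ Y, G.skew v u} Y)).1
  linarith

theorem IsOriented.sum_abs_signedSum_le [DecidableEq V] (hG : G.IsOriented) (ε : V → Bool) :
    ∑ v, |signedSum (G.skew v) Finset.univ ε| ≤ 12 * G.surplus := by
  have h1 := hG.sum_abs_sum_skew_le {u | ε u = true}
  have h2 := hG.sum_abs_sum_skew_le {u | ¬ ε u = true}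
  have h : ∀ v, |signedSum (G.skew v) Finset.univ ε| ≤
      |∑ u with ε u = true, G.skew v u| + |∑ u with ¬ ε u = true, G.skew v u| := by
    intro v
    refine le_trans (le_of_eq ?_) (abs_sub _ _)
    rw [signedSum, ← Finset.sum_filter_add_sum_filter_not _ (fun u => ε u = true), sub_eq_add_neg,
      ← Finset.sum_neg_distrib]
    congr 2
    · exact Finset.sum_congr rfl fun u hu => by simp [(Finset.mem_filter.1 hu).2]
    · exact Finset.sum_congr rfl fun u hu => by simp [(Finset.mem_filter.1 hu).2]
  calc _ ≤ _ := Finset.sum_le_sum fun v _ => h v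
    _ ≤ _ := by rw [Finset.sum_add_distrib]; linarith

/-- The vertices of degree at most `r ^ 2` have small total degree when the surplus is small. -/
theorem IsOriented.sum_degree_le (hG : G.IsOriented) {r : ℝ} (hr : 0 < r) (L : Finset V)
    (hL : ∀ v ∈ L, ∑ u, G.symInd v u ≤ r ^ 2) :
    ∑ v ∈ L, ∑ u, G.symInd v u ≤ 48 * r * G.surplus := by
  classical
  have h1 : ∀ v ∈ L, 2 ^ Fintype.card V * ∑ u, G.symInd v u ≤
      4 * r * ∑ ε, |signedSum (G.skew v) Finset.univ ε| := by
    intro v hv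
    simp only [← hG.skew_sq] at hL ⊢
    exact sum_sq_le_mul_sum_abs_signedSum _ _ hr (hL v hv)
  have h2 := Finset.sum_le_sum h1
  rw [← Finset.mul_sum, ← Finset.mul_sum,
    Finset.sum_comm (f := fun v ε => |signedSum (G.skew v) Finset.univ ε|)] at h2
  have h3 : ∑ ε : V → Bool, ∑ v ∈ L, |signedSum (G.skew v) Finset.univ ε| ≤
      ∑ ε : V → Bool, 12 * G.surplus := by
    refine Finset.sum_le_sum fun ε _ => le_trans ?_ (hG.sum_abs_signedSum_le ε)
    exact Finset.sum_le_sum_of_subset_of_nonneg (Finset.subset_univ _) fun _ _ _ => abs_nonneg _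
  simp only [Finset.sum_const, Finset.card_univ, Fintype.card_fun, Fintype.card_bool,
    nsmul_eq_mul, Nat.cast_pow, Nat.cast_ofNat] at h3
  refine le_of_mul_le_mul_left ?_ (by positivity : (0 : ℝ) < 2 ^ Fintype.card V)
  have := mul_le_mul_of_nonneg_left h3 (by positivity : 0 ≤ 4 * r)
  linarith

end LowDegree

end Digraph

namespace Digraph

/-! ### Counting orientations of complete bipartite graphs -/

section Counting

variable {U I J : Type*} [Fintype U] [Fintype I] [Fintype J] [DecidableEq I] [DecidableEq J]

/-- Resampling one coordinate. -/
theorem sum_sum_update (i : I) (F : (I → U) → ℝ) :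
    ∑ x : I → U, ∑ u : U, F (Function.update x i u) = Fintype.card U * ∑ x, F x := by
  have h : Function.Involutive fun p : (I → U) × U => (Function.update p.1 i p.2, p.1 i) :=
    fun p => by simp
  have h1 := Equiv.sum_comp h.toPerm fun p : (I → U) × U => F p.1
  rw [Fintype.sum_prod_type, Fintype.sum_prod_type] at h1
  simpa [Finset.mul_sum] using h1

/-- The indicator of an edge from `u` to `v`, or from `v` to `u` when `b` is false. -/
noncomputable def arc (G : Digraph U) (b : Bool) (u v : U) : ℝ :=
  if b then G.ind u v else G.ind v u

theorem arc_eq_zero_or_one {U : Type*} (G : Digraph U) (b : Bool) (u v : U) :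
    G.arc b u v = 0 ∨ G.arc b u v = 1 := by
  unfold arc; split_ifs <;> exact G.ind_eq_zero_or_one _ _

theorem prod_arc_eq_zero_or_one {U ι : Type*} (G : Digraph U) (s : Finset ι) (b : ι → Bool)
    (f g : ι → U) : ∏ q ∈ s, G.arc (b q) (f q) (g q) = 0 ∨
      ∏ q ∈ s, G.arc (b q) (f q) (g q) = 1 := by
  refine Finset.prod_induction _ (fun t : ℝ => t = 0 ∨ t = 1) ?_ (Or.inr rfl) fun q _ =>
    G.arc_eq_zero_or_one _ _ _
  rintro a b (rfl | rfl) (rfl | rfl) <;> simp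

/-- The number of homomorphisms to `G` from the orientation `o` of the complete bipartite graph
between `I` and `J`. -/
noncomputable def homCount (G : Digraph U) (o : I × J → Bool) : ℝ :=
  ∑ x : I → U, ∑ y : J → U, ∏ p : I × J, G.arc (o p) (x p.1) (y p.2)

variable {G : Digraph U} {D : ℝ}

theorem abs_sum_mul_mul_skew_le
    (hD : ∀ X Y : Finset U, |∑ u ∈ X, ∑ v ∈ Y, G.skew u v| ≤ D) {f g : U → ℝ}
    (hf : ∀ u, f u = 0 ∨ f u = 1) (hg : ∀ u, g u = 0 ∨ g u = 1) :
    |∑ u, ∑ v, G.skew u v * (f u * g v)| ≤ D := by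
  classical
  have h := hD {u | f u = 1} {v | g v = 1}
  simp only [Finset.sum_filter] at h
  have h2 : ∑ u, ∑ v, G.skew u v * (f u * g v) =
      ∑ u, if f u = 1 then ∑ v, if g v = 1 then G.skew u v else 0 else 0 := by
    refine Finset.sum_congr rfl fun u _ => ?_
    rcases hf u with h | h
    · simp [h]
    · simp only [h, one_mul, if_true]
      refine Finset.sum_congr rfl fun v _ => ?_
      rcases hg v with h | h <;> simp [h]
  rwa [h2]

/-- Fixing the images of all vertices but the two ends of `p`, the change is a bilinear form of the
skew matrix in two 0/1 vectors, hence at most `D`. -/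
theorem abs_homCount_update_sub_le
    (hD : ∀ X Y : Finset U, |∑ u ∈ X, ∑ v ∈ Y, G.skew u v| ≤ D)
    (o : I × J → Bool) (p : I × J) (b : Bool) :
    |G.homCount (Function.update o p b) - G.homCount o| * (Fintype.card U : ℝ) ^ 2 ≤
      D * (Fintype.card U : ℝ) ^ (Fintype.card I + Fintype.card J) := by
  have hD0 : 0 ≤ D := le_trans (abs_nonneg _) (hD ∅ ∅)
  rcases eq_or_ne b (o p) with rfl | hb
  · rw [Function.update_eq_self]
    simp only [sub_self, abs_zero, zero_mul]
    positivity
  set R : (I → U) → (J → U) → ℝ := fun x y =>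
    ∏ q ∈ Finset.univ.erase p, G.arc (o q) (x q.1) (y q.2) with hR
  obtain ⟨c, hc, hskew⟩ : ∃ c : ℝ, |c| = 1 ∧
      ∀ u v, G.arc b u v - G.arc (o p) u v = c * G.skew u v := by
    cases b <;> cases h : o p <;> simp_all [arc, skew]
    · exact ⟨-1, by norm_num, fun u v => by ring⟩
    · exact ⟨1, by norm_num, fun u v => by ring⟩
  have hdiff : ∀ x y, ∏ q, G.arc (Function.update o p b q) (x q.1) (y q.2) -
      ∏ q, G.arc (o q) (x q.1) (y q.2) = c * (G.skew (x p.1) (y p.2) * R x y) := by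
    intro x y
    rw [← Finset.mul_prod_erase _ _ (Finset.mem_univ p),
      ← Finset.mul_prod_erase _ (fun q => G.arc (o q) (x q.1) (y q.2)) (Finset.mem_univ p),
      Finset.prod_congr rfl fun q hq => by
        rw [Function.update_of_ne (Finset.ne_of_mem_erase hq)]]
    rw [Function.update_self, ← sub_mul, hskew]
    ring
  have hlocal : ∀ (x : I → U) (y : J → U), |∑ u, ∑ v, G.skew u v *
      R (Function.update x p.1 u) (Function.update y p.2 v)| ≤ D := by
    intro x y
    -- Only the removed factor `p` involves both resampled vertices, so the remaining product
    -- separates into a function of `u` and a function of `v`.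
    have hsplit : ∀ u v, R (Function.update x p.1 u) (Function.update y p.2 v) =
        (∏ q ∈ (Finset.univ.erase p).filter (fun q => ¬ q.2 = p.2),
          G.arc (o q) (Function.update x p.1 u q.1) (y q.2)) *
        (∏ q ∈ (Finset.univ.erase p).filter (fun q => q.2 = p.2),
          G.arc (o q) (x q.1) (Function.update y p.2 v q.2)) := by
      intro u v
      simp only [hR]
      rw [← Finset.prod_filter_not_mul_prod_filter _ (fun q : I × J => q.2 = p.2)]
      congr 1
      · refine Finset.prod_congr rfl fun q hq => ?_
        rw [Function.update_of_ne (Finset.mem_filter.1 hq).2]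
      · refine Finset.prod_congr rfl fun q hq => ?_
        obtain ⟨h1, h2⟩ := Finset.mem_filter.1 hq
        rw [Function.update_of_ne fun h => Finset.ne_of_mem_erase h1 (Prod.ext h h2)]
    simp only [hsplit]
    exact abs_sum_mul_mul_skew_le hD
      (fun u => G.prod_arc_eq_zero_or_one _ _ _ _) (fun u => G.prod_arc_eq_zero_or_one _ _ _ _)
  have hresample : (G.homCount (Function.update o p b) - G.homCount o) *
      (Fintype.card U : ℝ) ^ 2 = c * ∑ x : I → U, ∑ y : J → U, ∑ u, ∑ v, G.skew u v *
        R (Function.update x p.1 u) (Function.update y p.2 v) := by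
    have h1 : ∀ x : I → U, ∀ u, ∑ y : J → U, ∑ v, G.skew u v *
        R (Function.update x p.1 u) (Function.update y p.2 v) =
        Fintype.card U * ∑ y : J → U, G.skew (Function.update x p.1 u p.1) (y p.2) *
          R (Function.update x p.1 u) y := by
      intro x u
      rw [← sum_sum_update p.2]
      simp only [Function.update_self]
    have h2 : ∑ x : I → U, ∑ y : J → U, ∑ u, ∑ v, G.skew u v *
        R (Function.update x p.1 u) (Function.update y p.2 v) = Fintype.card U *
        (Fintype.card U * ∑ x : I → U, ∑ y : J → U, G.skew (x p.1) (y p.2) * R x y) := by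
      have h3 : ∀ x : I → U, ∑ y : J → U, ∑ u, ∑ v, G.skew u v *
          R (Function.update x p.1 u) (Function.update y p.2 v) = ∑ u, _ := fun x =>
        Finset.sum_comm.trans (Finset.sum_congr rfl fun u _ => h1 x u)
      simp only [h3, ← Finset.mul_sum]
      rw [sum_sum_update p.1 fun x => ∑ y : J → U, G.skew (x p.1) (y p.2) * R x y]
    rw [h2]
    unfold homCount
    simp only [← Finset.sum_sub_distrib, hdiff, ← Finset.mul_sum]
    ring
  rw [← abs_of_nonneg (by positivity : (0 : ℝ) ≤ (Fintype.card U : ℝ) ^ 2), ← abs_mul, hresample,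
    abs_mul, hc, one_mul]
  refine (Finset.abs_sum_le_sum_abs _ _).trans ?_
  refine (Finset.sum_le_sum fun x _ => (Finset.abs_sum_le_sum_abs _ _).trans
    (Finset.sum_le_sum fun y _ => hlocal x y)).trans (le_of_eq ?_)
  simp
  ring

theorem abs_homCount_sub_le
    (hD : ∀ X Y : Finset U, |∑ u ∈ X, ∑ v ∈ Y, G.skew u v| ≤ D) (o o' : I × J → Bool) :
    |G.homCount o' - G.homCount o| * (Fintype.card U : ℝ) ^ 2 ≤
      (Fintype.card I * Fintype.card J : ℕ) *
        (D * (Fintype.card U : ℝ) ^ (Fintype.card I + Fintype.card J)) := by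
  -- Pass from `o` to `o'` one edge at a time.
  have h : ∀ s : Finset (I × J), |G.homCount (s.piecewise o' o) - G.homCount o| *
      (Fintype.card U : ℝ) ^ 2 ≤
        s.card * (D * (Fintype.card U : ℝ) ^ (Fintype.card I + Fintype.card J)) := by
    intro s
    induction s using Finset.induction_on with
    | empty => simp
    | insert p s hp ih =>
      rw [Finset.piecewise_insert, Finset.card_insert_of_notMem hp]
      have h1 := abs_homCount_update_sub_le hD (s.piecewise o' o) p (o' p)
      have h2 := mul_le_mul_of_nonneg_right (abs_sub_le
        (G.homCount (Function.update (s.piecewise o' o) p (o' p)))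
        (G.homCount (s.piecewise o' o)) (G.homCount o))
        (by positivity : (0 : ℝ) ≤ (Fintype.card U : ℝ) ^ 2)
      push_cast
      linarith
  simpa [Finset.card_univ, Fintype.card_prod] using h Finset.univ

theorem sum_homCount :
    ∑ o : I × J → Bool, G.homCount o =
      ∑ x : I → U, ∑ y : J → U, ∏ p : I × J, G.symInd (x p.1) (y p.2) := by
  unfold homCount
  rw [Finset.sum_comm]
  refine Finset.sum_congr rfl fun x _ => ?_
  rw [Finset.sum_comm]
  refine Finset.sum_congr rfl fun y _ => ?_
  have h : ∀ p : I × J, G.symInd (x p.1) (y p.2) = ∑ b, G.arc b (x p.1) (y p.2) := fun p => by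
    simp [arc, symInd]
  simp only [h]
  rw [Finset.prod_univ_sum, Fintype.piFinset_univ]

/-- A lower bound of Kővári–Sós–Turán type for the number of homomorphisms from a complete
bipartite graph. -/
theorem pow_sum_le_mul_sum_prod [Nonempty U] [Nonempty I] [Nonempty J] {M : U → U → ℝ}
    (hM : ∀ u v, 0 ≤ M u v) :
    (∑ u, ∑ v, M u v) ^ (Fintype.card I * Fintype.card J) *
      (Fintype.card U : ℝ) ^ (Fintype.card I + Fintype.card J) ≤
      (Fintype.card U : ℝ) ^ (2 * (Fintype.card I * Fintype.card J)) *
        ∑ x : I → U, ∑ y : J → U, ∏ p : I × J, M (x p.1) (y p.2) := by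
  obtain ⟨a, ha⟩ := Nat.exists_eq_succ_of_ne_zero (Fintype.card_ne_zero (α := I))
  obtain ⟨b, hb⟩ := Nat.exists_eq_succ_of_ne_zero (Fintype.card_ne_zero (α := J))
  have hn : (0 : ℝ) < Fintype.card U := by exact_mod_cast Fintype.card_pos
  set n : ℝ := (Fintype.card U : ℝ) with hn'
  have h1 : ∑ x : I → U, ∑ y : J → U, ∏ p : I × J, M (x p.1) (y p.2) =
      ∑ y : J → U, (∑ u, ∏ j, M u (y j)) ^ (a + 1) := by
    rw [Finset.sum_comm]
    refine Finset.sum_congr rfl fun y _ => ?_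
    have h := Finset.prod_univ_sum (fun _ : I => (Finset.univ : Finset U))
      fun _ u => ∏ j, M u (y j)
    rw [Fintype.piFinset_univ, Finset.prod_const, Finset.card_univ, ha] at h
    rw [← Nat.succ_eq_add_one, h]
    refine Finset.sum_congr rfl fun x _ => ?_
    rw [Fintype.prod_prod_type]
  have h2 : ∑ y : J → U, ∑ u, ∏ j, M u (y j) = ∑ u, (∑ v, M u v) ^ (b + 1) := by
    rw [Finset.sum_comm]
    refine Finset.sum_congr rfl fun u _ => ?_
    have h := Finset.prod_univ_sum (fun _ : J => (Finset.univ : Finset U)) fun _ v => M u v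
    rw [Fintype.piFinset_univ, Finset.prod_const, Finset.card_univ, hb] at h
    exact h.symm
  -- Convexity is used twice: on common neighbourhoods of `J`-tuples, then on degrees.
  have j1 := pow_sum_div_card_le_sum_pow (s := Finset.univ)
    (f := fun y : J → U => ∑ u, ∏ j, M u (y j))
    (fun y _ => Finset.sum_nonneg fun u _ => Finset.prod_nonneg fun j _ => hM _ _) a
  have j2 := pow_sum_div_card_le_sum_pow (s := Finset.univ) (f := fun u : U => ∑ v, M u v)
    (fun u _ => Finset.sum_nonneg fun v _ => hM _ _) b
  rw [h2, ← h1] at j1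
  simp only [Finset.card_univ, Fintype.card_fun, hb, Nat.cast_pow, ← hn'] at j1 j2
  rw [div_le_iff₀ (by positivity)] at j1 j2
  have hS : 0 ≤ ∑ u, ∑ v, M u v := Finset.sum_nonneg fun u _ => Finset.sum_nonneg fun v _ => hM _ _
  have j3 := pow_le_pow_left₀ (by positivity) j2 (a + 1)
  set S := ∑ u, ∑ v, M u v
  set T := ∑ u, (∑ v, M u v) ^ (b + 1)
  set H := ∑ x : I → U, ∑ y : J → U, ∏ p : I × J, M (x p.1) (y p.2)
  rw [ha, hb]
  simp only [Nat.succ_eq_add_one] at j1 ⊢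
  calc S ^ ((a + 1) * (b + 1)) * n ^ (a + 1 + (b + 1))
      = (S ^ (b + 1)) ^ (a + 1) * n ^ (a + 1 + (b + 1)) := by rw [← pow_mul, mul_comm (a + 1)]
    _ ≤ (T * n ^ b) ^ (a + 1) * n ^ (a + 1 + (b + 1)) := by gcongr
    _ = T ^ (a + 1) * (n ^ (b * (a + 1)) * n ^ (a + 1 + (b + 1))) := by
        rw [mul_pow, ← pow_mul, mul_assoc]
    _ ≤ (H * (n ^ (b + 1)) ^ a) * (n ^ (b * (a + 1)) * n ^ (a + 1 + (b + 1))) := by gcongr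
    _ = n ^ (2 * ((a + 1) * (b + 1))) * H := by ring

open scoped Classical in
/-- Few maps are not injective. -/
theorem card_not_injective_mul_le :
    ((Finset.univ.filter fun x : I → U => ¬ Function.Injective x).card : ℝ) * Fintype.card U ≤
      (Fintype.card I : ℝ) ^ 2 * (Fintype.card U : ℝ) ^ Fintype.card I := by
  classical
  have hcoll : ∀ i j : I, i ≠ j →
      ((Finset.univ.filter fun x : I → U => x i = x j).card : ℝ) * Fintype.card U =
        (Fintype.card U : ℝ) ^ Fintype.card I := by
    intro i j hij
    have h := sum_sum_update i fun x : I → U => if x i = x j then (1 : ℝ) else 0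
    simp only [Function.update_self, Function.update_of_ne hij.symm] at h
    simp at h
    linarith
  have hsub : (Finset.univ.filter fun x : I → U => ¬ Function.Injective x) ⊆
      (Finset.univ : Finset I).offDiag.biUnion fun p =>
        Finset.univ.filter fun x : I → U => x p.1 = x p.2 := by
    intro x hx
    simp only [Finset.mem_filter, Finset.mem_univ, true_and, Function.Injective, not_forall] at hx
    obtain ⟨i, j, hxij, hij⟩ := hx
    simp only [Finset.mem_biUnion, Finset.mem_offDiag, Finset.mem_filter, Finset.mem_univ, true_and]
    exact ⟨(i, j), hij, hxij⟩
  have h1 : ((Finset.univ.filter fun x : I → U => ¬ Function.Injective x).card : ℝ) ≤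
      ∑ p ∈ (Finset.univ : Finset I).offDiag,
        ((Finset.univ.filter fun x : I → U => x p.1 = x p.2).card : ℝ) := by
    exact_mod_cast (Finset.card_le_card hsub).trans Finset.card_biUnion_le
  have h2 := mul_le_mul_of_nonneg_right h1 (Nat.cast_nonneg (α := ℝ) (Fintype.card U))
  rw [Finset.sum_mul, Finset.sum_congr rfl fun p hp =>
    hcoll p.1 p.2 (Finset.mem_offDiag.1 hp).2.2, Finset.sum_const, nsmul_eq_mul] at h2
  refine h2.trans (mul_le_mul_of_nonneg_right ?_ (by positivity))
  rw [sq]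
  have : (Finset.univ : Finset I).offDiag.card ≤ Fintype.card I * Fintype.card I := by
    rw [Finset.offDiag_card]; simp
  exact_mod_cast this

/-- Only pairs with a non-injective side contribute, each at most 1. -/
theorem homCount_mul_le (o : I × J → Bool)
    (h : ∀ (x : I → U) (y : J → U), Function.Injective x → Function.Injective y →
      ∏ p : I × J, G.arc (o p) (x p.1) (y p.2) = 0) :
    G.homCount o * Fintype.card U ≤ ((Fintype.card I : ℝ) ^ 2 + (Fintype.card J : ℝ) ^ 2) *
      (Fintype.card U : ℝ) ^ (Fintype.card I + Fintype.card J) := by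
  classical
  have hpt : ∀ (x : I → U) (y : J → U), ∏ p : I × J, G.arc (o p) (x p.1) (y p.2) ≤
      (if ¬ Function.Injective x then 1 else 0) + (if ¬ Function.Injective y then 1 else 0) := by
    intro x y
    by_cases hx : Function.Injective x <;> by_cases hy : Function.Injective y
    · simp [h x y hx hy, hx, hy]
    all_goals
      rcases G.prod_arc_eq_zero_or_one Finset.univ o (fun p => x p.1) (fun p => y p.2) with h | h <;>
      rw [h] <;> simp [hx, hy]
  have h1 : G.homCount o ≤ _ := Finset.sum_le_sum fun x (_ : x ∈ Finset.univ) =>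
    Finset.sum_le_sum fun y (_ : y ∈ Finset.univ) => hpt x y
  simp only [Finset.sum_add_distrib, Finset.sum_const, Finset.card_univ, Fintype.card_fun,
    nsmul_eq_mul, ← Finset.mul_sum, Finset.sum_boole, Nat.cast_pow] at h1
  have h2 := card_not_injective_mul_le (U := U) (I := I)
  have h3 := card_not_injective_mul_le (U := U) (I := J)
  calc _ ≤ _ := mul_le_mul_of_nonneg_right h1 (Nat.cast_nonneg (α := ℝ) (Fintype.card U))
    _ = (Fintype.card U : ℝ) ^ Fintype.card J * ((Finset.univ.filter fun x : I → U =>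
          ¬ Function.Injective x).card * Fintype.card U) +
        (Fintype.card U : ℝ) ^ Fintype.card I * ((Finset.univ.filter fun x : J → U =>
          ¬ Function.Injective x).card * Fintype.card U) := by ring
    _ ≤ _ := add_le_add (mul_le_mul_of_nonneg_left h2 (by positivity))
        (mul_le_mul_of_nonneg_left h3 (by positivity))
    _ = _ := by rw [pow_add]; ring

/-- A digraph with small discrepancy of orientations that avoids the orientation `o` of a complete
bipartite graph is sparse. -/
theorem pow_sum_symInd_mul_sq_le [Nonempty U] [Nonempty I] [Nonempty J]
    (hD : ∀ X Y : Finset U, |∑ u ∈ X, ∑ v ∈ Y, G.skew u v| ≤ D) (o : I × J → Bool)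
    (h : ∀ (x : I → U) (y : J → U), Function.Injective x → Function.Injective y →
      ∏ p : I × J, G.arc (o p) (x p.1) (y p.2) = 0) :
    (∑ u, ∑ v, G.symInd u v) ^ (Fintype.card I * Fintype.card J) * (Fintype.card U : ℝ) ^ 2 ≤
      2 ^ (Fintype.card I * Fintype.card J) *
      (Fintype.card U : ℝ) ^ (2 * (Fintype.card I * Fintype.card J)) *
      (((Fintype.card I : ℝ) ^ 2 + (Fintype.card J : ℝ) ^ 2) * Fintype.card U +
        Fintype.card I * Fintype.card J * D) := by
  have hn : (0 : ℝ) < Fintype.card U := by exact_mod_cast Fintype.card_pos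
  have h1 := pow_sum_le_mul_sum_prod (I := I) (J := J) G.symInd_nonneg
  rw [← sum_homCount] at h1
  have h2 : ∀ o' : I × J → Bool, G.homCount o' * (Fintype.card U : ℝ) ^ 2 ≤
      (((Fintype.card I : ℝ) ^ 2 + (Fintype.card J : ℝ) ^ 2) * Fintype.card U +
        Fintype.card I * Fintype.card J * D) *
        (Fintype.card U : ℝ) ^ (Fintype.card I + Fintype.card J) := by
    intro o'
    have h3 := abs_homCount_sub_le hD o o'
    have h4 := mul_le_mul_of_nonneg_right (homCount_mul_le o h) hn.le
    have h5 := mul_le_mul_of_nonneg_right (le_abs_self (G.homCount o' - G.homCount o))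
      (by positivity : (0 : ℝ) ≤ (Fintype.card U : ℝ) ^ 2)
    push_cast at h3
    linarith
  have h3 := Finset.sum_le_sum fun o' (_ : o' ∈ (Finset.univ : Finset (I × J → Bool))) => h2 o'
  rw [← Finset.sum_mul, Finset.sum_const, Finset.card_univ, Fintype.card_fun, Fintype.card_bool,
    Fintype.card_prod, nsmul_eq_mul] at h3
  push_cast at h3
  refine le_of_mul_le_mul_right ?_ (pow_pos hn (Fintype.card I + Fintype.card J))
  have h4 := mul_le_mul_of_nonneg_right h1 (by positivity : (0 : ℝ) ≤ (Fintype.card U : ℝ) ^ 2)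
  have h5 := mul_le_mul_of_nonneg_left h3 (by positivity :
    (0 : ℝ) ≤ (Fintype.card U : ℝ) ^ (2 * (Fintype.card I * Fintype.card J)))
  linarith

end Counting

end Digraph

/-! ### Finding B in an orientation of a complete bipartite graph -/

namespace Digraph

/-- The subdigraph induced by a finite set of vertices. -/
def induceFinset {V : Type*} (G : Digraph V) (U : Finset V) : Digraph U where
  Adj a b := G.Adj a b

theorem exists_orientation_prod_arc_eq_zero {W : Type*} [Fintype W] [DecidableEq W]
    {B : Digraph W} (hB : B.IsOriented) (hBip : B.IsBipartite) {U : Type*} {G : Digraph U}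
    (hG : G.IsOriented) (hfree : ¬ G.ContainsCopy B) :
    ∃ o : W × W → Bool, ∀ x y : W → U, Function.Injective x → Function.Injective y →
      ∏ p : W × W, G.arc (o p) (x p.1) (y p.2) = 0 := by
  classical
  obtain ⟨c⟩ := hBip
  have hc : ∀ a b, B.Adj a b → c a ≠ c b := by
    intro a b hab
    refine c.valid ?_
    refine ⟨fun h => hB.1 a (h ▸ hab), Or.inl hab⟩
  refine ⟨fun p => decide (B.Adj p.1 p.2), fun x y hx hy => ?_⟩
  by_contra hne
  have harc : ∀ a b, G.arc (decide (B.Adj a b)) (x a) (y b) ≠ 0 := fun a b =>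
    Finset.prod_ne_zero_iff.1 hne (a, b) (Finset.mem_univ _)
  -- Every pair across the two sides spans an arc and `G` has no loops, so the two images are
  -- disjoint; hence gluing `x` and `y` along the colouring is injective.
  have hxy : ∀ a b, x a ≠ y b := by
    intro a b h
    refine harc a b ?_
    rw [h]
    unfold arc ind
    simp [hG.1]
  refine hfree ⟨fun w => if c w = 0 then x w else y w, ?_, ?_⟩
  · intro a b hab
    simp only at hab
    split_ifs at hab
    · exact hx hab
    · exact absurd hab (hxy _ _)
    · exact absurd hab.symm (hxy _ _)
    · exact hy hab
  · intro a b hab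
    have hne := hc a b hab
    by_cases ha : c a = 0
    · have hb : c b ≠ 0 := fun hb => hne (ha.trans hb.symm)
      have h := harc a b
      simp only [hab, decide_true, arc, if_true, ind] at h
      simp only [ha, hb, if_true, if_false]
      by_contra h'
      exact h (if_neg h')
    · have hb : c b = 0 := by omega
      have h := harc b a
      simp only [hB.2 a b hab, arc, ind] at h
      simp only [ha, hb, if_true, if_false]
      by_contra h'
      simp [h'] at h

/-! ### Combining the two estimates -/

section Main

variable {V W : Type*} [Fintype V] [Fintype W] {G : Digraph V} {B : Digraph W}

theorem IsOriented.pow_sum_symInd_mul_sq_le [Nonempty W] (hB : B.IsOriented)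
    (hBip : B.IsBipartite) (hG : G.IsOriented) (hfree : ¬ G.ContainsCopy B) {U : Finset V}
    (hU : U.Nonempty) :
    (∑ u ∈ U, ∑ v ∈ U, G.symInd u v) ^ (Fintype.card W * Fintype.card W) * (U.card : ℝ) ^ 2 ≤
      2 ^ (Fintype.card W * Fintype.card W) *
      (U.card : ℝ) ^ (2 * (Fintype.card W * Fintype.card W)) *
      (2 * (Fintype.card W * Fintype.card W : ℕ) * U.card +
        3 * (Fintype.card W * Fintype.card W : ℕ) * G.surplus) := by
  classical
  have hne : Nonempty U := hU.to_subtype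
  have hH : (G.induceFinset U).IsOriented := ⟨fun a => hG.1 a, fun a b => hG.2 a b⟩
  have hHfree : ¬ (G.induceFinset U).ContainsCopy B := fun ⟨f, hf, hf'⟩ =>
    hfree ⟨fun w => f w, Subtype.val_injective.comp hf, hf'⟩
  obtain ⟨o, ho⟩ := exists_orientation_prod_arc_eq_zero hB hBip hH hHfree
  have hD : ∀ X Y : Finset U, |∑ u ∈ X, ∑ v ∈ Y, (G.induceFinset U).skew u v| ≤
      3 * G.surplus := by
    intro X Y
    have h := hG.abs_sum_skew_le (X.map (Function.Embedding.subtype _))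
      (Y.map (Function.Embedding.subtype _))
    simp only [Finset.sum_map] at h
    exact h
  have h := Digraph.pow_sum_symInd_mul_sq_le hD o ho
  have hsum : ∑ u, ∑ v, (G.induceFinset U).symInd u v = ∑ u ∈ U, ∑ v ∈ U, G.symInd u v := by
    rw [← Finset.sum_coe_sort U fun u => ∑ v ∈ U, G.symInd u v]
    refine Finset.sum_congr rfl fun u _ => ?_
    rw [← Finset.sum_coe_sort U]
    rfl
  rw [hsum, Fintype.card_coe] at h
  refine h.trans (le_of_eq ?_)
  push_cast
  ring

/-- All but few edges lie between vertices of large degree. -/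
theorem IsOriented.le_sum_symInd_compl (hG : G.IsOriented) {r : ℝ} (hr : 0 < r) (L : Finset V)
    [DecidableEq V] (hL : ∀ v ∈ L, ∑ u, G.symInd v u ≤ r ^ 2) :
    2 * (G.edges.ncard : ℝ) - 96 * r * G.surplus ≤ ∑ u ∈ Lᶜ, ∑ v ∈ Lᶜ, G.symInd u v := by
  have h1 := hG.sum_degree_le hr L hL
  have h2 := sum_symInd G
  rw [← Finset.sum_add_sum_compl L] at h2
  have h3 : ∑ u ∈ Lᶜ, ∑ v, G.symInd u v =
      ∑ u ∈ Lᶜ, ∑ v ∈ L, G.symInd u v + ∑ u ∈ Lᶜ, ∑ v ∈ Lᶜ, G.symInd u v := by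
    rw [← Finset.sum_add_distrib]
    exact Finset.sum_congr rfl fun u _ => (Finset.sum_add_sum_compl L _).symm
  have h4 : ∑ u ∈ Lᶜ, ∑ v ∈ L, G.symInd u v ≤ ∑ v ∈ L, ∑ u, G.symInd v u := by
    rw [Finset.sum_comm]
    refine Finset.sum_le_sum fun v _ => ?_
    simp only [fun u => G.symInd_swap v u]
    exact Finset.sum_le_sum_of_subset_of_nonneg (Finset.subset_univ _) fun _ _ _ =>
      G.symInd_nonneg _ _
  linarith

/-- Taking m as a power of `t` turns all exponents into integers: the claim is surplus ≥ m^(3/4 +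
1/(40(p+1))). -/
theorem IsOriented.pow_le_surplus [Nonempty W] (hB : B.IsOriented)
    (hBip : B.IsBipartite) (hG : G.IsOriented) (hfree : ¬ G.ContainsCopy B) {p : ℕ}
    (hp : Fintype.card W * Fintype.card W = p + 1) {t : ℝ}
    (ht : 100 * ((p + 1 : ℕ) : ℝ) * 8 ^ (p + 1) < t)
    (hm : t ^ (40 * (p + 1)) = G.edges.ncard) :
    t ^ (30 * (p + 1) + 1) ≤ G.surplus := by
  classical
  by_contra! hK
  have hq : (1 : ℝ) ≤ ((p + 1 : ℕ) : ℝ) := by exact_mod_cast Nat.succ_pos p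
  have h8 : (1 : ℝ) ≤ 8 ^ (p + 1) := one_le_pow₀ (by norm_num)
  have ht100 : 100 < t := by nlinarith
  have ht0 : 0 < t := by linarith
  have ht1 : 1 ≤ t := by linarith
  have hr : 0 < t ^ (10 * p + 8) := pow_pos ht0 _
  -- With r = t^(10p+8), r times the assumed bound on the surplus is m/t, so the loss 96m/t is below
  -- m.
  set L : Finset V := {v | ∑ u, G.symInd v u ≤ (t ^ (10 * p + 8)) ^ 2} with hLdef
  have hE := hG.le_sum_symInd_compl hr L fun v hv => (Finset.mem_filter.1 hv).2
  set E := ∑ u ∈ Lᶜ, ∑ v ∈ Lᶜ, G.symInd u v with hEdef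
  rw [← hm] at hE
  have hEm : t ^ (40 * (p + 1)) ≤ E := by
    have h1 : 96 * t ^ (10 * p + 8) * G.surplus ≤
        96 * t ^ (10 * p + 8) * t ^ (30 * (p + 1) + 1) := by gcongr
    have h2 : t ^ (40 * (p + 1)) = t * (t ^ (10 * p + 8) * t ^ (30 * (p + 1) + 1)) := by
      rw [← pow_add, ← pow_succ']; congr 1; ring
    have h3 : 0 ≤ t ^ (10 * p + 8) * t ^ (30 * (p + 1) + 1) := by positivity
    nlinarith
  have hU : Lᶜ.Nonempty := by
    by_contra h
    rw [Finset.not_nonempty_iff_eq_empty] at h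
    rw [hEdef, h, Finset.sum_empty] at hEm
    exact absurd hEm (not_le.2 (pow_pos ht0 _))
  have hn0 : (0 : ℝ) < (Lᶜ.card : ℝ) := by exact_mod_cast hU.card_pos
  have hn : (Lᶜ.card : ℝ) ≤ 2 * t ^ (20 * p + 24) := by
    have h1 : ∑ _v ∈ Lᶜ, (t ^ (10 * p + 8)) ^ 2 ≤ ∑ v ∈ Lᶜ, ∑ u, G.symInd v u := by
      refine Finset.sum_le_sum fun v hv => ?_
      by_contra h
      exact Finset.mem_compl.1 hv (Finset.mem_filter.2 ⟨Finset.mem_univ _, (not_le.1 h).le⟩)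
    have h2 : ∑ v ∈ Lᶜ, ∑ u, G.symInd v u ≤ ∑ v, ∑ u, G.symInd v u :=
      Finset.sum_le_sum_of_subset_of_nonneg (Finset.subset_univ _) fun _ _ _ =>
        Finset.sum_nonneg fun _ _ => G.symInd_nonneg _ _
    rw [sum_symInd, ← hm] at h2
    rw [Finset.sum_const, nsmul_eq_mul] at h1
    refine le_of_mul_le_mul_right ((h1.trans h2).trans (le_of_eq ?_)) (pow_pos hr 2)
    ring
  have hmain := IsOriented.pow_sum_symInd_mul_sq_le hB hBip hG hfree hU
  rw [hp, ← hEdef] at hmain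
  set n : ℝ := (Lᶜ.card : ℝ)
  set q : ℝ := ((p + 1 : ℕ) : ℝ)
  have h1 : E ^ (p + 1) ≤ 2 ^ (p + 1) * n ^ (2 * p) * (2 * q * n + 3 * q * G.surplus) := by
    refine le_of_mul_le_mul_right (hmain.trans (le_of_eq ?_)) (pow_pos hn0 2)
    ring
  have hn' : n ≤ 2 * t ^ (30 * (p + 1) + 1) := by
    refine hn.trans ?_
    have := pow_le_pow_right₀ ht1 (by omega : 20 * p + 24 ≤ 30 * (p + 1) + 1)
    linarith
  have hs := hG.surplus_nonneg
  have h2 : (t ^ (40 * (p + 1))) ^ (p + 1) ≤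
      2 ^ (p + 1) * (2 * t ^ (20 * p + 24)) ^ (2 * p) * (7 * q * t ^ (30 * (p + 1) + 1)) := by
    calc _ ≤ E ^ (p + 1) := by gcongr
      _ ≤ _ := h1
      _ ≤ _ := by
        have : 2 * q * n + 3 * q * G.surplus ≤ 7 * q * t ^ (30 * (p + 1) + 1) := by nlinarith
        gcongr
  -- The left side exceeds the power of `t` on the right by t^(2p+9); a single spare factor `t`
  -- already beats the constant.
  have h3 : (t ^ (40 * (p + 1))) ^ (p + 1) =
      t ^ (2 * p + 8) * (t * t ^ (40 * p ^ 2 + 78 * p + 31)) := by ring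
  have h4 : 2 ^ (p + 1) * (2 * t ^ (20 * p + 24)) ^ (2 * p) * (7 * q * t ^ (30 * (p + 1) + 1)) =
      2 ^ (p + 1) * 4 ^ p * (7 * q) * t ^ (40 * p ^ 2 + 78 * p + 31) := by
    rw [mul_pow, pow_mul 2 2 p]; norm_num; ring
  rw [h3, h4] at h2
  have h5 : (2 : ℝ) ^ (p + 1) * 4 ^ p ≤ 8 ^ (p + 1) := by
    rw [show (8 : ℝ) = 2 * 4 by norm_num, mul_pow]
    gcongr <;> norm_num
  have hT : 0 < t ^ (40 * p ^ 2 + 78 * p + 31) := pow_pos ht0 _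
  have h6 : t * t ^ (40 * p ^ 2 + 78 * p + 31) ≤
      8 ^ (p + 1) * (7 * q) * t ^ (40 * p ^ 2 + 78 * p + 31) := by
    refine le_trans (le_mul_of_one_le_left (by positivity) (one_le_pow₀ ht1)) (h2.trans ?_)
    gcongr
  have h7 := le_of_mul_le_mul_right h6 hT
  nlinarith

/-- Dividing by the threshold covers small `t` too: there the left side is at most 1, while any
digraph with an edge has surplus at least 1. -/
theorem IsOriented.div_pow_le_surplus [Nonempty W] (hB : B.IsOriented)
    (hBip : B.IsBipartite) (hG : G.IsOriented) (hfree : ¬ G.ContainsCopy B) {p : ℕ}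
    (hp : Fintype.card W * Fintype.card W = p + 1) {t : ℝ} (ht0 : 0 ≤ t)
    (hm : t ^ (40 * (p + 1)) = G.edges.ncard) :
    (t / (100 * ((p + 1 : ℕ) : ℝ) * 8 ^ (p + 1))) ^ (30 * (p + 1) + 1) ≤ G.surplus := by
  have hq : (1 : ℝ) ≤ ((p + 1 : ℕ) : ℝ) := by exact_mod_cast Nat.succ_pos p
  have h8 : (1 : ℝ) ≤ 8 ^ (p + 1) := one_le_pow₀ (by norm_num)
  have hT : (1 : ℝ) ≤ 100 * ((p + 1 : ℕ) : ℝ) * 8 ^ (p + 1) := by nlinarith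
  rcases ht0.eq_or_lt with rfl | htpos
  · simpa using hG.surplus_nonneg
  rcases le_or_gt t (100 * ((p + 1 : ℕ) : ℝ) * 8 ^ (p + 1)) with h | h
  · refine (pow_le_one₀ (by positivity) (div_le_one_of_le₀ h (by positivity))).trans
      (hG.one_le_surplus ?_)
    have : (0 : ℝ) < G.edges.ncard := hm ▸ pow_pos htpos _
    exact_mod_cast this
  · exact (pow_le_pow_left₀ (by positivity) (div_le_self ht0 hT) _).trans
      (IsOriented.pow_le_surplus hB hBip hG hfree hp h hm)

end Main

end Digraph

theorem theorem2 {W : Type*} [Finite W] (B : Digraph W)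
    (hB : B.IsOriented) (hBip : B.IsBipartite) :
    ∃ c : ℝ, 0 < c ∧ ∃ ε : ℝ, 0 < ε ∧
      ∀ (V : Type*) [Finite V] (G : Digraph V),
        G.IsOriented → ¬ G.ContainsCopy B →
          (G.minFeedbackArc : ℝ) ≤
            (G.edges.ncard : ℝ) / 2 - c * (G.edges.ncard : ℝ) ^ ((3 : ℝ) / 4 + ε) := by
  have := Fintype.ofFinite W
  rcases isEmpty_or_nonempty W with hW | hW
  -- The empty digraph is contained in every `G`, so the constants are arbitrary.
  · exact ⟨1, one_pos, 1, one_pos, fun V _ G _ hfree =>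
      absurd ⟨isEmptyElim, fun a => isEmptyElim a, fun a => isEmptyElim a⟩ hfree⟩
  obtain ⟨p, hp⟩ := Nat.exists_eq_succ_of_ne_zero
    (mul_ne_zero (Fintype.card_ne_zero (α := W)) (Fintype.card_ne_zero (α := W)))
  set T : ℝ := 100 * ((p + 1 : ℕ) : ℝ) * 8 ^ (p + 1) with hT
  have hT0 : 0 < T := by positivity
  have hN : (0 : ℝ) < ((40 * (p + 1) : ℕ) : ℝ) := by positivity
  -- The half comes from β = (m − surplus)/2, and the exponent from (30(p+1) + 1)/(40(p+1)).
  refine ⟨(1 / T) ^ (30 * (p + 1) + 1) / 2, by positivity, 1 / ((40 * (p + 1) : ℕ) : ℝ),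
    by positivity, fun V _ G hG hfree => ?_⟩
  have := Fintype.ofFinite V
  set m : ℝ := (G.edges.ncard : ℝ) with hm
  have hm0 : 0 ≤ m := Nat.cast_nonneg _
  have ht : (m ^ (1 / ((40 * (p + 1) : ℕ) : ℝ))) ^ (40 * (p + 1)) = m := by
    rw [← Real.rpow_natCast, ← Real.rpow_mul hm0, one_div_mul_cancel hN.ne', Real.rpow_one]
  have hpow : (m ^ (1 / ((40 * (p + 1) : ℕ) : ℝ))) ^ (30 * (p + 1) + 1) =
      m ^ ((3 : ℝ) / 4 + 1 / ((40 * (p + 1) : ℕ) : ℝ)) := by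
    rw [← Real.rpow_natCast, ← Real.rpow_mul hm0]
    congr 1
    push_cast
    field_simp
    ring
  have h := Digraph.IsOriented.div_pow_le_surplus hB hBip hG hfree hp
    (Real.rpow_nonneg hm0 _) ht
  rw [← hT, div_eq_mul_one_div, mul_pow, hpow] at h
  unfold Digraph.surplus at h
  linarith
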